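/- Let $q$ be a prime power, let $r$ and $t$ be integers with $2 \le t \le r$, and let $\mathcal{Q} = \Omega^+(2r,q)$ be a hyperbolic polar space of rank $r$: the set of all totally singular subspaces of a $2r$-dimensional vector space over $\mathbb{F}_q$ with respect to a non-singular quadratic form whose maximal totally singular subspaces (the generators) have vector space dimension $r$. Let $D$ be a $t$-$(r,r,1)_{\Omega^+(q)}$ Steiner system, that is, a set of generators of $\mathcal{Q}$ such that every $t$-dimensional subspace of $\mathcal{Q}$ is contained in exactly one element of $D$. Then $D$ is either the complete design (the set of all generators), in which case $t = r$, or a Latin-Greek design, in which case $t = r-1$. Here a Latin-Greek design is one of the two parts (Latins and Greeks) of the partition of the generators in which two generators $B, B'$ lie in the same part if and only if $r - \dim(B \cap B')$ is even. In particular, no $t$-$(r,r,1)_{\Omega^+(q)}$ Steiner system exists for $2 \le t \le r-2$. -/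

import Mathlib

namespace PolarSpace

variable {F V : Type*} [Field F] [AddCommGroup V] [Module F V]

/-- `W` is a totally singular subspace, i.e. a subspace of the polar space of `Q`. -/
def IsTotallySingular (Q : QuadraticForm F V) (W : Submodule F V) : Prop :=
  ∀ v ∈ W, Q v = 0

/-- `Q` is non-singular: no nonzero singular vector is orthogonal to all of `V`. -/
def IsNonsingular (Q : QuadraticForm F V) : Prop :=
  ∀ v : V, Q v = 0 → (∀ w : V, QuadraticMap.polar Q v w = 0) → v = 0

/-- The polar space of `Q` has rank `r`: the maximal dimension of a totally singular
subspace is `r`. -/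
def HasRank (Q : QuadraticForm F V) (r : ℕ) : Prop :=
  IsGreatest {d : ℕ | ∃ W : Submodule F V, IsTotallySingular Q W ∧ Module.finrank F W = d} r

/-- The totally singular subspaces of `Q` form a hyperbolic polar space `Ω⁺(2r, F)`:
`Q` is non-singular, `V` has dimension `2r`, and the rank is `r`. -/
structure IsHyperbolic (Q : QuadraticForm F V) (r : ℕ) : Prop where
  nonsingular : IsNonsingular Q
  finrank_eq : Module.finrank F V = 2 * r
  hasRank : HasRank Q r

/-- The set of all `k`-dimensional subspaces of the polar space of `Q`
(the complete design with block dimension `k`). -/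
def completeDesign (Q : QuadraticForm F V) (k : ℕ) : Set (Submodule F V) :=
  {B | IsTotallySingular Q B ∧ Module.finrank F B = k}

/-- `D` is a `t-(r, k, lam)` design in the polar space of `Q` (of rank `r`). -/
structure IsDesign (Q : QuadraticForm F V) (t r k lam : ℕ) (D : Set (Submodule F V)) :
    Prop where
  strength_le : t ≤ r
  blockDim_le : k ≤ r
  isBlock : ∀ B ∈ D, IsTotallySingular Q B ∧ Module.finrank F B = k
  balanced : ∀ T : Submodule F V, IsTotallySingular Q T → Module.finrank F T = t →
    {B ∈ D | T ≤ B}.ncard = lam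

/-- A Steiner system is a design with `lam = 1`. -/
def IsSteinerSystem (Q : QuadraticForm F V) (t r k : ℕ) (D : Set (Submodule F V)) : Prop :=
  IsDesign Q t r k 1 D

/-- `D` is one of the two classes (Latins and Greeks) of generators of a hyperbolic polar space
of rank `r`. The classes are `D` and its complement in the set of generators, and two generators
`B`, `B'` are in the same class if and only if `r - dim (B ∩ B')` is even. -/
structure IsLatinGreek (Q : QuadraticForm F V) (r : ℕ) (D : Set (Submodule F V)) : Prop where
  subset_generators : D ⊆ completeDesign Q r
  same_class_iff : ∀ B ∈ completeDesign Q r, ∀ B' ∈ completeDesign Q r,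
    ((B ∈ D ↔ B' ∈ D) ↔ Even (r - Module.finrank F (B ⊓ B' : Submodule F V)))

end PolarSpace

/-! Write q for `Nat.card F`. If t ≤ r - 2, fix a block B and a (t - 2)-space U in B, and double
count pairs (v, C) with v in B \ U and C ≠ B a block on U and v. The number of blocks on U and on
each U + ⟨v⟩ is forced (`ncard_blocks`), while uniqueness bounds dim (B ∩ C) by t - 1; the two are
incompatible (`le_of_isSteinerSystem`). If t = r, each generator lies in a block, hence is one. If t
= r - 1, each (r - 1)-space lies in at most two generators (`eq_or_eq_of_le`), so exactly one of two
adjacent generators is in D. Stepping from one generator to another through neighbours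
(`exists_neighbour`) turns this into the parity condition. -/

open Module Submodule

/-! ### Hyperplane sections and dimensions of subspaces. -/

section LinearAlgebra

variable {F V : Type*} [Field F] [AddCommGroup V] [Module F V] [FiniteDimensional F V]

theorem Submodule.finrank_inf_ker_add_one {G : Submodule F V} {φ : V →ₗ[F] F} {g : V}
    (hg : g ∈ G) (hφ : φ g ≠ 0) :
    finrank F (G ⊓ LinearMap.ker φ : Submodule F V) + 1 = finrank F G := by
  have hn : g ∉ G ⊓ LinearMap.ker φ := fun h => hφ h.2
  rw [← finrank_sup_span_singleton hn]
  suffices h : (G ⊓ LinearMap.ker φ) ⊔ span F {g} = G by rw [h]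
  refine le_antisymm (sup_le inf_le_left ((span_singleton_le_iff_mem _ _).2 hg)) fun x hx => ?_
  refine mem_sup.2 ⟨x - (φ x / φ g) • g, ⟨sub_mem hx (smul_mem _ _ hg), ?_⟩, (φ x / φ g) • g,
    smul_mem _ _ (mem_span_singleton_self g), by simp⟩
  simp [hφ]

theorem Submodule.exists_le_finrank_eq (B : Submodule F V) {k : ℕ} (hk : k ≤ finrank F B) :
    ∃ W ≤ B, finrank F W = k := by
  induction k with
  | zero => exact ⟨⊥, bot_le, finrank_bot F V⟩
  | succ k ih =>
    obtain ⟨W, hWB, hW⟩ := ih (by omega)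
    obtain ⟨v, hvB, hvW⟩ : ∃ v ∈ B, v ∉ W := by
      by_contra! h
      have := finrank_mono (show B ≤ W from h)
      omega
    exact ⟨W ⊔ span F {v}, sup_le hWB (by simpa using hvB),
      by rw [finrank_sup_span_singleton hvW, hW]⟩

theorem Submodule.sup_span_singleton_eq_of_finrank {W B : Submodule F V} {v : V} (hWB : W ≤ B)
    (hv : v ∈ B) (hvW : v ∉ W) (h : finrank F B = finrank F W + 1) : W ⊔ span F {v} = B :=
  eq_of_le_of_finrank_eq (sup_le hWB (by simpa using hv))
    (by rw [finrank_sup_span_singleton hvW, h])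

end LinearAlgebra

/-! ### Geometry of generators, and the case t = r - 1. -/

namespace PolarSpace

variable {F V : Type*} [Field F] [AddCommGroup V] [Module F V] {Q : QuadraticForm F V} {r : ℕ}

/-- The orthogonal complement of `W` with respect to the polar form of `Q`. -/
def perp (Q : QuadraticForm F V) (W : Submodule F V) : Submodule F V :=
  LinearMap.BilinForm.orthogonal Q.polarBilin W

theorem mem_perp {W : Submodule F V} {v : V} :
    v ∈ perp Q W ↔ ∀ w ∈ W, QuadraticMap.polar Q w v = 0 := Iff.rfl

theorem perp_anti {W W' : Submodule F V} (h : W ≤ W') : perp Q W' ≤ perp Q W :=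
  fun _ hv w hw => hv w (h hw)

theorem map_add_eq (v w : V) : Q (v + w) = Q v + Q w + QuadraticMap.polar Q v w := by
  simp [QuadraticMap.polar]

theorem IsTotallySingular.mono {W W' : Submodule F V} (hW : IsTotallySingular Q W)
    (h : W' ≤ W) : IsTotallySingular Q W' := fun v hv => hW v (h hv)

theorem IsTotallySingular.polar_eq_zero {W : Submodule F V} (hW : IsTotallySingular Q W)
    {v w : V} (hv : v ∈ W) (hw : w ∈ W) : QuadraticMap.polar Q v w = 0 := by
  simp [QuadraticMap.polar, hW _ hv, hW _ hw, hW _ (add_mem hv hw)]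

theorem IsTotallySingular.le_perp {W W' : Submodule F V} (hW : IsTotallySingular Q W)
    (h : W' ≤ W) : W ≤ perp Q W' := fun _ hv _ hw => hW.polar_eq_zero (h hw) hv

theorem IsTotallySingular.sup {W W' : Submodule F V} (hW : IsTotallySingular Q W)
    (hW' : IsTotallySingular Q W') (h : W' ≤ perp Q W) : IsTotallySingular Q (W ⊔ W') := by
  intro v hv
  obtain ⟨a, ha, b, hb, rfl⟩ := mem_sup.1 hv
  rw [map_add_eq, hW a ha, hW' b hb, mem_perp.1 (h hb) a ha, add_zero, add_zero]

theorem isTotallySingular_span_singleton {v : V} (hv : Q v = 0) :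
    IsTotallySingular Q (span F {v}) := by
  intro w hw
  obtain ⟨c, rfl⟩ := mem_span_singleton.1 hw
  simp [QuadraticMap.map_smul, hv]

theorem IsTotallySingular.sup_span_singleton {W : Submodule F V} {v : V}
    (hW : IsTotallySingular Q W) (hv : Q v = 0) (h : v ∈ perp Q W) :
    IsTotallySingular Q (W ⊔ span F {v}) :=
  hW.sup (isTotallySingular_span_singleton hv) (by simpa using h)

theorem HasRank.finrank_le (hr : HasRank Q r) {W : Submodule F V}
    (hW : IsTotallySingular Q W) : finrank F W ≤ r := hr.2 ⟨W, hW, rfl⟩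

theorem IsSteinerSystem.existsUnique {t : ℕ} {D : Set (Submodule F V)}
    (hD : IsSteinerSystem Q t r r D) {T : Submodule F V} (hT : IsTotallySingular Q T)
    (ht : finrank F T = t) : ∃! B, B ∈ D ∧ T ≤ B := by
  obtain ⟨B, hB⟩ := Set.ncard_eq_one.1 (hD.balanced T hT ht)
  have h : ∀ C, C ∈ D ∧ T ≤ C ↔ C = B := fun C => by
    rw [← Set.mem_singleton_iff, ← hB]
    rfl
  exact ⟨B, (h B).2 rfl, fun C hC => (h C).1 hC⟩

theorem IsSteinerSystem.subset_completeDesign {t : ℕ} {D : Set (Submodule F V)}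
    (hD : IsSteinerSystem Q t r r D) : D ⊆ completeDesign Q r := hD.isBlock

variable [FiniteDimensional F V]

/-- In characteristic 2 the hypothesis only excludes singular vectors from the radical of the polar
form; this suffices, since `W` is totally singular and so meets the radical trivially. -/
theorem IsHyperbolic.finrank_add_finrank_perp (hQ : IsHyperbolic Q r) {W : Submodule F V}
    (hW : IsTotallySingular Q W) : finrank F W + finrank F (perp Q W) = 2 * r := by
  have h := LinearMap.BilinForm.finrank_add_finrank_orthogonal' (B := Q.polarBilin) W
  have h0 : W ⊓ LinearMap.ker Q.polarBilin = ⊥ := by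
    refine eq_bot_iff.2 fun v hv => ?_
    refine (mem_bot F).2 (hQ.nonsingular v (hW v hv.1) fun w => ?_)
    exact LinearMap.congr_fun (LinearMap.mem_ker.1 hv.2) w
  rw [h0, finrank_bot, add_zero, hQ.finrank_eq] at h
  exact h

theorem IsHyperbolic.perp_generator (hQ : IsHyperbolic Q r) {G : Submodule F V}
    (hG : G ∈ completeDesign Q r) : perp Q G = G := by
  have h := hQ.finrank_add_finrank_perp hG.1
  have := hG.2
  exact (eq_of_le_of_finrank_eq (hG.1.le_perp le_rfl) (by omega)).symm

/-- For any generator G, the space U + (U^⊥ ∩ G) is a generator: U^⊥ + G ≤ (U ∩ G)^⊥ makes U^⊥ ∩ G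
large enough. -/
theorem IsHyperbolic.exists_generator_ge (hQ : IsHyperbolic Q r) {U : Submodule F V}
    (hU : IsTotallySingular Q U) : ∃ G ∈ completeDesign Q r, U ≤ G := by
  obtain ⟨G, hG, hGr⟩ := hQ.hasRank.1
  have hts : IsTotallySingular Q (U ⊔ (perp Q U ⊓ G)) :=
    hU.sup (hG.mono inf_le_right) inf_le_left
  refine ⟨_, ⟨hts, le_antisymm (hQ.hasRank.finrank_le hts) ?_⟩, le_sup_left⟩
  have h1 := finrank_sup_add_finrank_inf_eq U (perp Q U ⊓ G)
  have h2 := finrank_sup_add_finrank_inf_eq (perp Q U) G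
  have h3 := hQ.finrank_add_finrank_perp hU
  have h4 := hQ.finrank_add_finrank_perp (hU.mono (inf_le_left : U ⊓ G ≤ U))
  have h5 : finrank F (perp Q U ⊔ G : Submodule F V) ≤ finrank F (perp Q (U ⊓ G)) :=
    finrank_mono (sup_le (perp_anti inf_le_left) (hG.le_perp inf_le_right))
  have h6 : finrank F (U ⊓ (perp Q U ⊓ G) : Submodule F V) ≤ finrank F (U ⊓ G : Submodule F V) :=
    finrank_mono (inf_le_inf_left _ inf_le_right)
  omega

theorem eq_of_mem_completeDesign_of_le {B B' : Submodule F V} (hB : B ∈ completeDesign Q r)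
    (hB' : B' ∈ completeDesign Q r) (h : B ≤ B') : B = B' :=
  eq_of_le_of_finrank_eq h (hB.2.trans hB'.2.symm)

/-- A totally singular subspace of dimension `r - 1` lies in at most two generators. -/
theorem IsHyperbolic.eq_or_eq_of_le (hQ : IsHyperbolic Q r) {T B B' C : Submodule F V}
    (hT : finrank F T + 1 = r) (hB : B ∈ completeDesign Q r) (hB' : B' ∈ completeDesign Q r)
    (hC : C ∈ completeDesign Q r) (hTB : T ≤ B) (hTB' : T ≤ B') (hTC : T ≤ C) (hne : B ≠ B') :
    C = B ∨ C = B' := by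
  have key : ∀ {X : Submodule F V} {z : V}, X ∈ completeDesign Q r → T ≤ X → z ∈ C → z ∉ T →
      z ∈ X → C = X := by
    intro X z hX hTX hzC hzT hzX
    rw [← sup_span_singleton_eq_of_finrank hTC hzC hzT (by rw [hC.2, hT]),
      ← sup_span_singleton_eq_of_finrank hTX hzX hzT (by rw [hX.2, hT])]
  obtain ⟨z, hzC, hzT⟩ : ∃ z ∈ C, z ∉ T := by
    by_contra! h
    have := finrank_mono (show C ≤ T from h)
    have := hC.2
    omega
  obtain ⟨y, hyB', hyB⟩ : ∃ y ∈ B', y ∉ B := by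
    by_contra! h
    exact hne (eq_of_mem_completeDesign_of_le hB' hB h).symm
  have hsup : B ⊔ span F {y} = perp Q T := by
    refine sup_span_singleton_eq_of_finrank (hB.1.le_perp hTB) (hB'.1.le_perp hTB' hyB') hyB ?_
    have := hQ.finrank_add_finrank_perp (hB.1.mono hTB)
    have := hB.2
    omega
  have hz : z ∈ B ⊔ span F {y} := hsup ▸ hC.1.le_perp hTC hzC
  obtain ⟨b, hb, w, hw, rfl⟩ := mem_sup.1 hz
  have hwB' : w ∈ B' := (span_le.2 (by simpa using hyB')) hw
  -- Since b, w and b + w are all singular, b ⊥ w. If w ∉ T, then B' = T + ⟨w⟩, so b ∈ B'^⊥ = B'.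
  have hbw : QuadraticMap.polar Q b w = 0 := by
    have := hC.1 _ hzC
    rwa [map_add_eq, hB.1 b hb, hB'.1 w hwB', add_zero, zero_add] at this
  by_cases hwT : w ∈ T
  · exact .inl (key hB hTB hzC hzT (add_mem hb (hTB hwT)))
  · right
    have hb' : b ∈ perp Q B' := by
      intro x hx
      rw [← sup_span_singleton_eq_of_finrank hTB' hwB' hwT (by rw [hB'.2, hT])] at hx
      obtain ⟨u, hu, v, hv, rfl⟩ := mem_sup.1 hx
      obtain ⟨c, rfl⟩ := mem_span_singleton.1 hv
      have h1 := hB.1.polar_eq_zero (hTB hu) hb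
      rw [QuadraticMap.polar_comm] at hbw
      change QuadraticMap.polar Q (u + c • w) b = 0
      rw [QuadraticMap.polar_add_left, QuadraticMap.polar_smul_left, h1, hbw]
      simp
    rw [hQ.perp_generator hB'] at hb'
    exact key hB' hTB' hzC hzT (add_mem hb' hwB')

/-- Two distinct generators `B`, `B'` are joined by a neighbour `C` of `B'` which is one step
closer to `B`. -/
theorem IsHyperbolic.exists_neighbour (hQ : IsHyperbolic Q r) {B B' : Submodule F V}
    (hB : B ∈ completeDesign Q r) (hB' : B' ∈ completeDesign Q r) (hne : B ≠ B') :
    ∃ C ∈ completeDesign Q r, finrank F (C ⊓ B' : Submodule F V) + 1 = r ∧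
      finrank F (B ⊓ C : Submodule F V) = finrank F (B ⊓ B' : Submodule F V) + 1 := by
  obtain ⟨v, hvB, hvB'⟩ : ∃ v ∈ B, v ∉ B' := by
    by_contra! h
    exact hne (eq_of_mem_completeDesign_of_le hB hB' h)
  obtain ⟨g, hg, hvg⟩ : ∃ g ∈ B', Q.polarBilin v g ≠ 0 := by
    by_contra! h
    apply hvB'
    rw [← hQ.perp_generator hB']
    intro w hw
    rw [← h w hw]
    exact QuadraticMap.polar_comm _ _ _
  -- The neighbour is (B' ∩ v^⊥) + ⟨v⟩; it keeps B ∩ B' and gains v.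
  set H := B' ⊓ LinearMap.ker (Q.polarBilin v) with hH
  have hHr : finrank F H + 1 = r := by rw [hH, finrank_inf_ker_add_one hg hvg, hB'.2]
  have hvH : v ∉ H := fun h => hvB' h.1
  have hv : v ∈ perp Q H := by
    intro w hw
    exact (QuadraticMap.polar_comm _ _ _).trans (LinearMap.mem_ker.1 hw.2)
  have hBH : B ⊓ B' ≤ H := fun x hx => ⟨hx.2, hB.1.polar_eq_zero hvB hx.1⟩
  have hinf : (H ⊔ span F {v}) ⊓ B' = H := by
    refine le_antisymm (fun x hx => ?_) (le_inf le_sup_left inf_le_left)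
    obtain ⟨u, hu, w, hw, rfl⟩ := mem_sup.1 hx.1
    obtain ⟨c, rfl⟩ := mem_span_singleton.1 hw
    have hc : c • v ∈ B' := by simpa using sub_mem hx.2 hu.1
    rcases eq_or_ne c 0 with rfl | h0
    · simpa using hu
    · exact absurd ((smul_mem_iff _ h0).1 hc) hvB'
  refine ⟨H ⊔ span F {v}, ⟨(hB'.1.mono inf_le_left).sup_span_singleton (hB.1 v hvB) hv,
    by rw [finrank_sup_span_singleton hvH, hHr]⟩, by rw [hinf, hHr], ?_⟩
  have h2 : B ⊓ (H ⊔ span F {v}) = (B ⊓ B') ⊔ span F {v} := by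
    refine le_antisymm (fun x hx => ?_)
      (sup_le (le_inf inf_le_left (hBH.trans le_sup_left))
        (le_inf (by simpa using hvB) le_sup_right))
    obtain ⟨u, hu, w, hw, rfl⟩ := mem_sup.1 hx.2
    have hwB : w ∈ B := (span_le.2 (by simpa using hvB)) hw
    have huB : u ∈ B := by simpa using sub_mem hx.1 hwB
    exact mem_sup.2 ⟨u, ⟨huB, hu.1⟩, w, hw, rfl⟩
  have hvi : v ∉ B ⊓ B' := fun h => hvB' h.2
  rw [h2, finrank_sup_span_singleton hvi]

/-- A set of generators such that every `(r - 1)`-dimensional singular subspace lies in exactly one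
of them is a class of Latins or Greeks. -/
theorem IsHyperbolic.isLatinGreek_of_existsUnique (hQ : IsHyperbolic Q r)
    {D : Set (Submodule F V)} (hD : D ⊆ completeDesign Q r)
    (h : ∀ T : Submodule F V, IsTotallySingular Q T → finrank F T + 1 = r →
      ∃! B, B ∈ D ∧ T ≤ B) : IsLatinGreek Q r D := by
  refine ⟨hD, ?_⟩
  have hadj : ∀ B ∈ completeDesign Q r, ∀ B' ∈ completeDesign Q r,
      finrank F (B ⊓ B' : Submodule F V) + 1 = r → (B ∈ D ↔ B' ∉ D) := by
    intro B hB B' hB' hr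
    have hne : B ≠ B' := by
      rintro rfl
      rw [inf_idem, hB.2] at hr
      omega
    obtain ⟨C, ⟨hCD, hTC⟩, huniq⟩ := h _ (hB.1.mono (inf_le_left : B ⊓ B' ≤ B)) hr
    refine ⟨fun h1 h2 => hne ((huniq B ⟨h1, inf_le_left⟩).trans
      (huniq B' ⟨h2, inf_le_right⟩).symm), fun h2 => ?_⟩
    rcases hQ.eq_or_eq_of_le hr hB hB' (hD hCD) inf_le_left inf_le_right hTC hne with rfl | rfl
    · exact hCD
    · exact absurd hCD h2
  suffices H : ∀ d, ∀ B ∈ completeDesign Q r, ∀ B' ∈ completeDesign Q r,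
      r - finrank F (B ⊓ B' : Submodule F V) = d → ((B ∈ D ↔ B' ∈ D) ↔ Even d) from
    fun B hB B' hB' => H _ B hB B' hB' rfl
  intro d
  induction d with
  | zero =>
    intro B hB B' hB' hd
    have h1 : B ⊓ B' = B := eq_of_le_of_finrank_le inf_le_left (by rw [hB.2]; omega)
    obtain rfl := eq_of_mem_completeDesign_of_le hB hB' (inf_eq_left.1 h1)
    simp
  | succ d ih =>
    intro B hB B' hB' hd
    have hne : B ≠ B' := by
      rintro rfl
      rw [inf_idem, hB.2] at hd
      omega
    obtain ⟨C, hC, h1, h2⟩ := hQ.exists_neighbour hB hB' hne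
    have h3 := ih B hB C hC (by omega)
    have h4 := hadj C hC B' hB' h1
    rw [Nat.even_add_one, ← h3]
    tauto

end PolarSpace

/-! ### Double counting and cardinalities of subspaces. -/

theorem Set.ncard_mul_le_ncard_mul {α β : Type*} [Finite α] [Finite β] {s : Set α} {t : Set β}
    (R : α → β → Prop) {m n : ℕ} (hm : ∀ a ∈ s, m ≤ {b ∈ t | R a b}.ncard)
    (hn : ∀ b ∈ t, {a ∈ s | R a b}.ncard ≤ n) : s.ncard * m ≤ t.ncard * n := by
  classical
  have := Fintype.ofFinite α
  have := Fintype.ofFinite β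
  rw [Set.ncard_eq_toFinset_card', Set.ncard_eq_toFinset_card']
  refine Finset.card_mul_le_card_mul R (fun a ha => ?_) fun b hb => ?_
  · convert hm a (by simpa using ha) using 1
    rw [Set.ncard_eq_toFinset_card']
    congr 1
    ext; simp [Finset.mem_bipartiteAbove]
  · convert hn b (by simpa using hb) using 1
    rw [Set.ncard_eq_toFinset_card']
    congr 1
    ext; simp [Finset.mem_bipartiteBelow]

theorem Set.ncard_mul_eq_ncard_mul {α β : Type*} [Finite α] [Finite β] {s : Set α} {t : Set β}
    (R : α → β → Prop) {m n : ℕ} (hm : ∀ a ∈ s, {b ∈ t | R a b}.ncard = m)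
    (hn : ∀ b ∈ t, {a ∈ s | R a b}.ncard = n) : s.ncard * m = t.ncard * n :=
  (ncard_mul_le_ncard_mul R (fun a ha => (hm a ha).ge) fun b hb => (hn b hb).le).antisymm
    (ncard_mul_le_ncard_mul (fun b a => R a b) (fun b hb => (hn b hb).ge)
      fun a ha => (hm a ha).le)

section LinearAlgebra

variable {F V : Type*} [Field F] [AddCommGroup V] [Module F V] [FiniteDimensional F V]

theorem Submodule.ncard_coe_eq_pow_finrank (W : Submodule F V) :
    (W : Set V).ncard = Nat.card F ^ finrank F W := by
  rw [← Nat.card_coe_set_eq]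
  exact Module.natCard_eq_pow_finrank (K := F) (V := W)

theorem Submodule.ncard_fiber_mul {G : Submodule F V} {φ : V →ₗ[F] F} {g : V}
    (hg : g ∈ G) (hφ : φ g ≠ 0) (c : F) :
    {x | x ∈ G ∧ φ x = c}.ncard * Nat.card F = Nat.card F ^ finrank F G := by
  have h : {x | x ∈ G ∧ φ x = c} =
      (fun x => (c / φ g) • g + x) '' (G ⊓ LinearMap.ker φ : Submodule F V) := by
    ext x
    constructor
    · rintro ⟨hx, rfl⟩
      exact ⟨x - (φ x / φ g) • g, ⟨sub_mem hx (smul_mem _ _ hg), by simp [hφ]⟩, by simp⟩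
    · rintro ⟨y, ⟨hy, hy0⟩, rfl⟩
      refine ⟨add_mem (smul_mem _ _ hg) hy, ?_⟩
      have : φ y = 0 := hy0
      simp [this, hφ]
  rw [h, Set.ncard_image_of_injective _ (add_right_injective _), ncard_coe_eq_pow_finrank,
    ← pow_succ, finrank_inf_ker_add_one hg hφ]

variable [Finite F]

theorem Submodule.ncard_diff_add {U W : Submodule F V} (h : U ≤ W) :
    ((W : Set V) \ U).ncard + Nat.card F ^ finrank F U = Nat.card F ^ finrank F W := by
  have : Finite V := Module.finite_of_finite F
  rw [← ncard_coe_eq_pow_finrank, ← ncard_coe_eq_pow_finrank]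
  exact Set.ncard_sdiff_add_ncard_of_subset h

end LinearAlgebra

/-! ### Counting singular vectors and blocks. -/

namespace PolarSpace

variable {F V : Type*} [Field F] [Finite F] [AddCommGroup V] [Module F V] [FiniteDimensional F V]
  {Q : QuadraticForm F V} {r : ℕ}

/-- Each coset of a generator `G` outside `G` has a fraction `1 / q` of singular vectors. -/
theorem IsHyperbolic.ncard_singular_diff_generator (hQ : IsHyperbolic Q r) {U G : Submodule F V}
    (hG : G ∈ completeDesign Q r) (hU : U ≤ G) :
    {v | v ∈ (perp Q U : Set V) \ G ∧ Q v = 0}.ncard * Nat.card F =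
      ((perp Q U : Set V) \ G).ncard := by
  have : Finite V := Module.finite_of_finite F
  have hGU : G ≤ perp Q U := hG.1.le_perp hU
  have hq : 0 < Nat.card F ^ r := pow_pos Nat.card_pos _
  -- On v + G, Q(v + x) = Q(v) + polar(v, x) is affine in x, and nonconstant because v ∉ G = G^⊥.
  have h1 : ∀ v ∈ (perp Q U : Set V) \ G,
      {w ∈ {v | v ∈ (perp Q U : Set V) \ G ∧ Q v = 0} | w - v ∈ G}.ncard * Nat.card F =
        Nat.card F ^ r := by
    rintro v ⟨hvU, hvG⟩
    obtain ⟨g, hg, hvg⟩ : ∃ g ∈ G, Q.polarBilin v g ≠ 0 := by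
      by_contra! h
      apply hvG
      rw [← hQ.perp_generator hG]
      intro w hw
      rw [← h w hw]
      exact QuadraticMap.polar_comm _ _ _
    rw [← hG.2, ← ncard_fiber_mul hg hvg (-Q v),
      ← Set.ncard_image_of_injective {x | x ∈ G ∧ Q.polarBilin v x = -Q v}
        (add_right_injective v)]
    suffices h : {w ∈ {v | v ∈ (perp Q U : Set V) \ G ∧ Q v = 0} | w - v ∈ G} =
        (fun x => v + x) '' {x | x ∈ G ∧ Q.polarBilin v x = -Q v} by rw [h]
    ext w
    constructor
    · rintro ⟨⟨-, hw⟩, hwv⟩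
      refine ⟨w - v, ⟨hwv, ?_⟩, by simp⟩
      have h := map_add_eq (Q := Q) v (w - v)
      rw [add_sub_cancel, hw, hG.1 _ hwv, add_zero] at h
      exact (neg_eq_of_add_eq_zero_right h.symm).symm
    · rintro ⟨x, ⟨hx, hvx⟩, rfl⟩
      refine ⟨⟨⟨add_mem hvU (hGU hx), fun h => hvG ?_⟩, ?_⟩, by simpa using hx⟩
      · simpa using sub_mem h hx
      · rw [map_add_eq, hG.1 x hx]
        have : QuadraticMap.polar Q v x = - Q v := hvx
        rw [this]
        ring
  have h2 : ∀ w ∈ {v | v ∈ (perp Q U : Set V) \ G ∧ Q v = 0},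
      {v ∈ (perp Q U : Set V) \ G | w - v ∈ G}.ncard = Nat.card F ^ r := by
    rintro w ⟨⟨hwU, hwG⟩, -⟩
    rw [← hG.2, ← ncard_coe_eq_pow_finrank,
      ← Set.ncard_image_of_injective (G : Set V) (sub_right_injective (b := w))]
    congr 1
    ext v
    constructor
    · rintro ⟨-, h⟩
      exact ⟨w - v, h, by simp⟩
    · rintro ⟨x, hx, rfl⟩
      refine ⟨⟨sub_mem hwU (hGU hx), fun h => hwG ?_⟩, by simpa using hx⟩
      simpa using add_mem h hx
  have hF : 0 < Nat.card F := Nat.card_pos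
  have h3 := Set.ncard_mul_eq_ncard_mul (fun v w => w - v ∈ G)
    (fun v hv => (Nat.eq_div_of_mul_eq_left hF.ne' (h1 v hv))) h2
  rcases ((perp Q U : Set V) \ G).eq_empty_or_nonempty with h | ⟨v, hv⟩
  · simp [h]
  · have h4 := h1 v hv
    rw [Nat.eq_div_of_mul_eq_left hF.ne' h4] at h4
    apply Nat.eq_of_mul_eq_mul_right hq
    rw [mul_right_comm, ← h3, mul_assoc, h4]

/-- The number of singular vectors outside `U` and orthogonal to `U`. -/
theorem IsHyperbolic.ncard_singular_perp_diff (hQ : IsHyperbolic Q r) {U : Submodule F V} {k : ℕ}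
    (hU : IsTotallySingular Q U) (hk : finrank F U + 1 + k = r) :
    {v | v ∈ perp Q U ∧ v ∉ U ∧ Q v = 0}.ncard =
      (Nat.card F ^ r - Nat.card F ^ finrank F U) * (Nat.card F ^ k + 1) := by
  have : Finite V := Module.finite_of_finite F
  -- G \ U gives the summand 1 of the second factor; the singular vectors of U^⊥ \ G give q^k.
  obtain ⟨G, hG, hUG⟩ := hQ.exists_generator_ge hU
  have hGU : G ≤ perp Q U := hG.1.le_perp hUG
  have hset : {v | v ∈ perp Q U ∧ v ∉ U ∧ Q v = 0} =
      {v | v ∈ (perp Q U : Set V) \ G ∧ Q v = 0} ∪ (G : Set V) \ U := by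
    ext v
    constructor
    · rintro ⟨h1, h2, h3⟩
      by_cases h : v ∈ G
      · exact .inr ⟨h, h2⟩
      · exact .inl ⟨⟨h1, h⟩, h3⟩
    · rintro (⟨⟨h1, h2⟩, h3⟩ | ⟨h1, h2⟩)
      · exact ⟨h1, fun h => h2 (hUG h), h3⟩
      · exact ⟨hGU h1, h2, hG.1 v h1⟩
  have hdisj : Disjoint {v | v ∈ (perp Q U : Set V) \ G ∧ Q v = 0} ((G : Set V) \ U) :=
    Set.disjoint_left.2 fun v h1 h2 => h1.1.2 h2.1
  rw [hset, Set.ncard_union_eq hdisj]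
  have h1 := hQ.ncard_singular_diff_generator hG hUG
  have h2 := ncard_diff_add hGU
  have h3 := ncard_diff_add hUG
  have h4 := hQ.finrank_add_finrank_perp hU
  rw [← h1, hG.2, show finrank F (perp Q U) = r + (k + 1) by omega, pow_add] at h2
  rw [hG.2] at h3
  set q := Nat.card F
  set e := ((G : Set V) \ U).ncard
  have h5 : q ^ finrank F U * q ^ (k + 1) = q ^ r := by rw [← pow_add]; congr 1; omega
  have hq : 0 < q := Nat.card_pos
  rw [← h3, Nat.add_sub_cancel, mul_add, mul_one, Nat.add_right_cancel_iff]
  apply Nat.eq_of_mul_eq_mul_right hq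
  apply Nat.add_right_cancel (m := q ^ r)
  rw [h2, ← h3, add_mul, h5, h3]
  ring

/-- In a set of generators, the number of blocks on each `(s + 1)`-space determines the number of
blocks on each `s`-space. -/
theorem IsHyperbolic.ncard_blocks (hQ : IsHyperbolic Q r) {D : Set (Submodule F V)}
    (hD : D ⊆ completeDesign Q r) {s k L : ℕ} (hk : s + 1 + k = r)
    (hL : ∀ T : Submodule F V, IsTotallySingular Q T → finrank F T = s + 1 →
      {B ∈ D | T ≤ B}.ncard = L)
    {U : Submodule F V} (hU : IsTotallySingular Q U) (hs : finrank F U = s) :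
    {B ∈ D | U ≤ B}.ncard = L * (Nat.card F ^ k + 1) := by
  have : Finite V := Module.finite_of_finite F
  have : Finite (Submodule F V) := Finite.of_injective _ SetLike.coe_injective
  -- Pairs (v, B) with v singular in U^⊥ \ U and B a block on U containing v.
  have h := Set.ncard_mul_eq_ncard_mul (s := {v | v ∈ perp Q U ∧ v ∉ U ∧ Q v = 0})
    (t := {B ∈ D | U ≤ B}) (m := L) (n := Nat.card F ^ r - Nat.card F ^ s) (fun v B => v ∈ B)
    (by
      rintro v ⟨h1, h2, h3⟩
      rw [← hL _ (hU.sup_span_singleton h3 h1) (by rw [finrank_sup_span_singleton h2, hs])]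
      congr 1
      ext B
      simp [and_assoc])
    (by
      rintro B ⟨hBD, hUB⟩
      have hB := hD hBD
      rw [← hs, ← hB.2, ← ncard_diff_add hUB, Nat.add_sub_cancel]
      congr 1
      ext v
      exact ⟨fun h => ⟨h.2, h.1.2.1⟩,
        fun h => ⟨⟨hB.1.le_perp hUB h.1, h.2, hB.1 v h.1⟩, h.1⟩⟩)
  rw [hQ.ncard_singular_perp_diff hU (by rw [hs]; exact hk), hs] at h
  have he : 0 < Nat.card F ^ r - Nat.card F ^ s :=
    Nat.sub_pos_of_lt (Nat.pow_lt_pow_right Finite.one_lt_card (by omega))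
  apply Nat.eq_of_mul_eq_mul_left he
  rw [mul_comm, ← h]
  ring

/-- A Steiner system with `t ≥ 2` has `t ≥ r - 1`: otherwise the blocks meeting a given block in
dimension `t - 1` and containing a given `(t - 2)`-space outnumber all the blocks on that space. -/
theorem IsHyperbolic.le_of_isSteinerSystem (hQ : IsHyperbolic Q r) {s : ℕ}
    {D : Set (Submodule F V)} (hD : IsSteinerSystem Q (s + 2) r r D) : r ≤ s + 3 := by
  by_contra! hlt
  obtain ⟨k, rfl⟩ : ∃ k, r = s + 4 + k := ⟨r - (s + 4), by omega⟩
  have : Finite V := Module.finite_of_finite F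
  have : Finite (Submodule F V) := Finite.of_injective _ SetLike.coe_injective
  have hDc := hD.subset_completeDesign
  have hl1 := fun (U : Submodule F V) (h : IsTotallySingular Q U) (h' : finrank F U = s + 1) =>
    hQ.ncard_blocks hDc (s := s + 1) (k := k + 2) (by omega) hD.balanced h h'
  have hl0 := fun (U : Submodule F V) (h : IsTotallySingular Q U) (h' : finrank F U = s) =>
    hQ.ncard_blocks hDc (s := s) (k := k + 3) (by omega) hl1 h h'
  simp only [one_mul] at hl1 hl0
  obtain ⟨W, hW, hWr⟩ := hQ.hasRank.1
  obtain ⟨T, hTW, hTs⟩ := W.exists_le_finrank_eq (k := s + 2) (by omega)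
  obtain ⟨B, ⟨hBD, hTB⟩, -⟩ := hD.existsUnique (hW.mono hTW) hTs
  obtain ⟨U, hUT, hUs⟩ := T.exists_le_finrank_eq (k := s) (by omega)
  have hUB := hUT.trans hTB
  have hB := hDc hBD
  have hle := Set.ncard_mul_le_ncard_mul (s := (B : Set V) \ U) (t := {C ∈ D | U ≤ C} \ {B})
    (m := Nat.card F ^ (k + 2)) (n := Nat.card F ^ (s + 1) - Nat.card F ^ s) (fun v C => v ∈ C)
    (by
      rintro v ⟨hvB, hvU⟩
      have hUv : U ⊔ span F {v} ≤ B := sup_le hUB ((span_singleton_le_iff_mem _ _).2 hvB)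
      have h := hl1 _ (hB.1.mono hUv) (by rw [finrank_sup_span_singleton hvU, hUs])
      have hmem : B ∈ {C ∈ D | U ⊔ span F {v} ≤ C} := ⟨hBD, hUv⟩
      rw [← Set.ncard_sdiff_singleton_add_one hmem, Nat.add_right_cancel_iff] at h
      rw [← h]
      refine Set.ncard_le_ncard ?_
      rintro C ⟨⟨hCD, hC⟩, hCB⟩
      exact ⟨⟨⟨hCD, le_sup_left.trans hC⟩, hCB⟩,
        hC (mem_sup_right (mem_span_singleton_self v))⟩)
    (by
      rintro C ⟨⟨hCD, hUC⟩, hCB⟩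
      have hdim : finrank F (B ⊓ C : Submodule F V) ≤ s + 1 := by
        by_contra! h
        obtain ⟨X, hX, hXs⟩ := (B ⊓ C).exists_le_finrank_eq (k := s + 2) (by omega)
        obtain ⟨E, -, hE⟩ := hD.existsUnique (hB.1.mono (hX.trans inf_le_left)) hXs
        exact hCB ((hE C ⟨hCD, hX.trans inf_le_right⟩).trans
          (hE B ⟨hBD, hX.trans inf_le_left⟩).symm)
      have h := ncard_diff_add (le_inf hUB hUC)
      rw [hUs] at h
      have h' := Nat.pow_le_pow_right (Nat.card_pos (α := F)) hdim
      refine (Set.ncard_le_ncard (t := ((B ⊓ C : Submodule F V) : Set V) \ U) ?_).trans (by omega)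
      exact fun v hv => ⟨⟨hv.1.1, hv.2⟩, hv.1.2⟩)
  have h0 := hl0 U (hB.1.mono hUB) hUs
  have hmem : B ∈ {C ∈ D | U ≤ C} := ⟨hBD, hUB⟩
  rw [← Set.ncard_sdiff_singleton_add_one hmem] at h0
  have h1 := ncard_diff_add hUB
  rw [hB.2, hUs] at h1
  have hq : 1 < Nat.card F := Finite.one_lt_card
  set q := Nat.card F
  set n := ({C ∈ D | U ≤ C} \ {B}).ncard
  set e := ((B : Set V) \ U).ncard
  obtain ⟨p, hp⟩ : ∃ p, q = p + 1 := ⟨q - 1, by omega⟩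
  have hqs : 0 < q ^ s := by positivity
  have h2 : q ^ (s + 1) - q ^ s = q ^ s * p := by
    rw [pow_succ, hp, mul_add, mul_one, Nat.add_sub_cancel]
  rw [h2] at hle
  set a := q ^ (k + 2) with ha
  -- This is where t ≤ r - 2 enters; for t = r - 1 the analogue of a would be q.
  have haq : q * q ≤ a := by
    rw [← pow_two]
    exact Nat.pow_le_pow_right (by omega) (by omega)
  have hn : n = a * (a * q + 1 + q) := by
    apply Nat.add_right_cancel (m := 1)
    rw [h0, pow_succ q (k + 2), ← ha]
    ring
  have h3 : e + q ^ s = q ^ s * (q * q * a) := by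
    rw [h1, ha]
    ring
  have h4 : e ≤ q ^ s * ((a * q + 1 + q) * p) := by
    apply Nat.le_of_mul_le_mul_right _ (show 0 < a by positivity)
    calc e * a ≤ n * (q ^ s * p) := hle
      _ = q ^ s * ((a * q + 1 + q) * p) * a := by rw [hn]; ring
  have h5 : q * q * a ≤ (a * q + 1 + q) * p + 1 := by
    apply Nat.le_of_mul_le_mul_left _ hqs
    rw [← h3, mul_add, mul_one]
    -- Here e = q^s (q²a - 1); the subtraction of q^s is moved across as + 1.
    omega
  -- With `h5` this leaves aq ≤ q² ≤ a, impossible for q ≥ 2.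
  have h6 : (a * q + 1 + q) * p + 1 + a * q = q * q * a + q * q := by
    rw [hp]
    ring
  have h7 : a * 2 ≤ a * q := Nat.mul_le_mul_left a hq
  have h8 : 0 < q * q := by positivity
  omega

end PolarSpace

theorem mainTheorem2 {F V : Type*} [Field F] [Finite F] [AddCommGroup V] [Module F V]
    [FiniteDimensional F V] (Q : QuadraticForm F V) (r t : ℕ)
    (hQ : PolarSpace.IsHyperbolic Q r) (ht : 2 ≤ t) (D : Set (Submodule F V))
    (hD : PolarSpace.IsSteinerSystem Q t r r D) :
    (t = r ∧ D = PolarSpace.completeDesign Q r) ∨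
      (t + 1 = r ∧ PolarSpace.IsLatinGreek Q r D) := by
  have htr : t ≤ r := hD.strength_le
  have hrt : r ≤ t + 1 := by
    obtain ⟨s, rfl⟩ := Nat.exists_eq_add_of_le' ht
    exact hQ.le_of_isSteinerSystem hD
  have hDc := hD.subset_completeDesign
  rcases htr.eq_or_lt with rfl | hlt
  · refine .inl ⟨rfl, hDc.antisymm fun B hB => ?_⟩
    obtain ⟨C, ⟨hCD, hBC⟩, -⟩ := hD.existsUnique hB.1 hB.2
    rwa [PolarSpace.eq_of_mem_completeDesign_of_le hB (hDc hCD) hBC]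
  · refine .inr ⟨by omega, hQ.isLatinGreek_of_existsUnique hDc fun T hT hTr => ?_⟩
    exact hD.existsUnique hT (by omega)
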